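/- Let $n>2$ be an integer and let $G$ and $H$ be $2$-groups of maximal class of order $2^n$, i.e. groups of order $2^n$ and nilpotency class $n-1$. For a group $G$, let the centralizer lattice $\mathcal{C}(G)$ be the set of all subgroups of the form $\mathbf{C}_G(X)$ with $X\subseteq G$, ordered by inclusion, with meet $A\wedge B=A\cap B$, join $A\vee B=\mathbf{C}_G(\mathbf{C}_G(A)\cap\mathbf{C}_G(B))$, and the involution $A\mapsto\mathbf{C}_G(A)$. Then the centralizer lattices of $G$ and $H$ are isomorphic: there is a bijection $f:\mathcal{C}(G)\to\mathcal{C}(H)$ with $f(A\wedge B)=f(A)\wedge f(B)$, $f(A\vee B)=f(A)\vee f(B)$ and $f(\mathbf{C}_G(A))=\mathbf{C}_H(f(A))$ for all $A,B\in\mathcal{C}(G)$. -/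

import Mathlib

/-- `G` is a `p`-group of maximal class: it has order `p ^ n` for some `n ≥ 2`, and its
nilpotency class is `n - 1`. (The class is then positive, so it is not the default value `0`
that `Group.nilpotencyClass` takes at groups which are not nilpotent.) -/
def IsPGroupOfMaximalClass (p : ℕ) (G : Type*) [Group G] : Prop :=
  ∃ n : ℕ, 2 ≤ n ∧ Nat.card G = p ^ n ∧ Group.nilpotencyClass G + 1 = n

/-- The underlying set of the centralizer lattice of `G`: the subgroups of the form `C_G(X)`
for some subset `X` of `G`. -/
def CentralizerLattice (G : Type*) [Group G] : Type _ :=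
  {K : Subgroup G // ∃ X : Set G, K = Subgroup.centralizer X}

namespace CentralizerLattice

variable {G : Type*} [Group G]

/-- The subgroup of `G` underlying an element of the centralizer lattice. -/
def toSubgroup (A : CentralizerLattice G) : Subgroup G := A.1

@[ext]
theorem ext {A B : CentralizerLattice G} (h : A.toSubgroup = B.toSubgroup) : A = B :=
  Subtype.ext h

/-- The centralizer `C_G(X)` of a subset `X`, as an element of the centralizer lattice. -/
def ofSet (X : Set G) : CentralizerLattice G := ⟨Subgroup.centralizer X, X, rfl⟩

/-- The involution `A ↦ C_G(A)` of the centralizer lattice. -/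
def cent (A : CentralizerLattice G) : CentralizerLattice G := ofSet (A.toSubgroup : Set G)

/-- The order is inclusion of subgroups. -/
instance : PartialOrder (CentralizerLattice G) := PartialOrder.lift toSubgroup fun _ _ => ext

theorem le_def {A B : CentralizerLattice G} : A ≤ B ↔ A.toSubgroup ≤ B.toSubgroup := Iff.rfl

theorem toSubgroup_cent (A : CentralizerLattice G) :
    A.cent.toSubgroup = Subgroup.centralizer (A.toSubgroup : Set G) := rfl

theorem cent_anti {A B : CentralizerLattice G} (h : A ≤ B) : B.cent ≤ A.cent :=
  Subgroup.centralizer_le h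

theorem cent_cent (A : CentralizerLattice G) : A.cent.cent = A := by
  obtain ⟨_, X, rfl⟩ := A
  apply ext
  apply le_antisymm
  · apply Subgroup.centralizer_le
    intro x hx g hg
    exact (hg x hx).symm
  · exact Subgroup.le_centralizer_iff.1 le_rfl

/-- The meet of two centralizers is their intersection, which is the centralizer of the union
of their centralizers. -/
def meet (A B : CentralizerLattice G) : CentralizerLattice G :=
  ⟨A.toSubgroup ⊓ B.toSubgroup,
    (A.cent.toSubgroup : Set G) ∪ (B.cent.toSubgroup : Set G), by
      conv_lhs => rw [← cent_cent A, ← cent_cent B]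
      ext g
      simp only [toSubgroup_cent, Subgroup.mem_inf, Subgroup.mem_centralizer_iff, Set.mem_union,
        or_imp, forall_and, SetLike.mem_coe]⟩

/-- Meet is intersection, and the join is `A ∨ B = C_G(C_G(A) ∧ C_G(B))`. -/
instance : Lattice (CentralizerLattice G) where
  inf := meet
  inf_le_left A B := (inf_le_left : A.toSubgroup ⊓ B.toSubgroup ≤ _)
  inf_le_right A B := (inf_le_right : A.toSubgroup ⊓ B.toSubgroup ≤ _)
  le_inf A B C hB hC := (le_inf hB hC : A.toSubgroup ≤ B.toSubgroup ⊓ C.toSubgroup)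
  sup A B := cent (meet A.cent B.cent)
  le_sup_left A B := by
    have h : meet A.cent B.cent ≤ A.cent :=
      (inf_le_left : A.cent.toSubgroup ⊓ B.cent.toSubgroup ≤ _)
    simpa only [cent_cent] using cent_anti h
  le_sup_right A B := by
    have h : meet A.cent B.cent ≤ B.cent :=
      (inf_le_right : A.cent.toSubgroup ⊓ B.cent.toSubgroup ≤ _)
    simpa only [cent_cent] using cent_anti h
  sup_le A B C hA hB := by
    have h : C.cent ≤ meet A.cent B.cent :=
      (le_inf (cent_anti hA) (cent_anti hB) :
        C.cent.toSubgroup ≤ A.cent.toSubgroup ⊓ B.cent.toSubgroup)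
    simpa only [cent_cent] using cent_anti h

/-- The top element is `G = C_G(∅)` and the bottom element is the center `C_G(G)`. -/
instance : BoundedOrder (CentralizerLattice G) where
  top := ofSet ∅
  le_top A := by
    intro g _ x hx
    exact hx.elim
  bot := ofSet Set.univ
  bot_le A := by
    obtain ⟨_, X, rfl⟩ := A
    exact Subgroup.centralizer_le (Set.subset_univ X)

end CentralizerLattice

/-- A centralizer lattice homomorphism: a lattice homomorphism that respects the centralizer
involution. -/
structure CentralizerLatticeHom (G H : Type*) [Group G] [Group H] extends
    LatticeHom (CentralizerLattice G) (CentralizerLattice H) where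
  map_cent' : ∀ A : CentralizerLattice G, toFun A.cent = (toFun A).cent

/-- An isomorphism of centralizer lattices: a pair of mutually inverse centralizer lattice
homomorphisms. -/
structure CentralizerLatticeIso (G H : Type*) [Group G] [Group H] where
  hom : CentralizerLatticeHom G H
  inv : CentralizerLatticeHom H G
  left_inv : Function.LeftInverse inv.toFun hom.toFun
  right_inv : Function.RightInverse inv.toFun hom.toFun

/-! A 2-group of maximal class and order `2 ^ n`, `n > 2`, has center `Z` of order two and a cyclic
subgroup `A` of index two. An abelian subgroup of index two makes the centralizer of every
noncentral element abelian. Hence every member of the lattice other than `⊥` and `⊤` is its own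
centralizer, and these members are pairwise incomparable. They are `A` and the `C_G(x)` with `x ∉
A`, one for each coset of `Z` outside `A`, so the lattice has `2 ^ (n - 2) + 3` elements. Any
bijection between two such lattices that matches `⊤` and `⊥` is then an isomorphism.

The cyclic subgroup is found by induction through `G ⧸ center G`
(`exists_orderOf_eq_of_nilpotencyClass`); the count is `CentralizerLattice.card_eq`. -/

/-! ### The center and a cyclic subgroup of index two -/

open Subgroup in
/-- A `2`-group of class at least two has a central quotient whose order is bounded below by
its class. -/
theorem exists_card_quotient_center_eq {n : ℕ} : ∀ {G : Type*} [Group G],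
    Nat.card G = 2 ^ n → 2 ≤ Group.nilpotencyClass G →
    ∃ m < n, Nat.card (G ⧸ center G) = 2 ^ m ∧ Group.nilpotencyClass G ≤ m := by
  induction n using Nat.strong_induction_on with
  | _ n ih =>
    intro G _ hcard hclass
    have : Fact (Nat.Prime 2) := ⟨Nat.prime_two⟩
    have hfin : Finite G := Nat.finite_of_card_ne_zero (by rw [hcard]; positivity)
    have hp : IsPGroup 2 G := IsPGroup.of_card hcard
    have : Group.IsNilpotent G := hp.isNilpotent
    have : Nontrivial G := by
      by_contra h
      rw [not_nontrivial_iff_subsingleton] at h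
      have := Group.nilpotencyClass_zero_iff_subsingleton.2 h
      omega
    have : Nontrivial (center G) := hp.center_nontrivial
    obtain ⟨m, hm⟩ := (IsPGroup.iff_card (p := 2)).1 (hp.to_quotient (center G))
    have hZ : 1 < Nat.card (center G) := Finite.one_lt_card
    have hmul := card_eq_card_quotient_mul_card_subgroup (center G)
    rw [hcard, hm] at hmul
    have hmn : m < n := by
      refine (Nat.pow_lt_pow_iff_right (le_refl 2)).1 ?_
      rw [hmul]
      exact lt_mul_of_one_lt_right (by positivity) hZ
    refine ⟨m, hmn, hm, ?_⟩
    have hc := Group.nilpotencyClass_eq_quotient_center_plus_one (G := G)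
    by_cases h2 : 2 ≤ Group.nilpotencyClass (G ⧸ center G)
    · obtain ⟨k, hk, -, hck⟩ := ih m hmn hm h2
      omega
    -- Here the class of `G` is at most 2, and `m < 2` would make the central quotient cyclic and
    -- `G` abelian.
    · have : 2 ≤ m := by
        by_contra hlt
        have hcyc : IsCyclic (G ⧸ center G) := by
          have : m = 0 ∨ m = 1 := by omega
          rcases this with rfl | rfl
          · have := (Nat.card_eq_one_iff_unique.1 (by simpa using hm)).1
            infer_instance
          · exact isCyclic_of_prime_card (p := 2) (by simpa using hm)
        have hcomm := (QuotientGroup.mk' (center G)).isMulCommutative_of_isCyclic_of_ker_le_center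
          (by simp)
        have : Group.nilpotencyClass G ≤ 1 := by
          rw [Group.IsNilpotent.nilpotencyClass_le_one_iff]
          exact hcomm
        omega
      omega

-- The exponent of the central quotient lies between the class `n` and `n + 1`, the latter excluded.
open Subgroup in
theorem card_quotient_center_of_nilpotencyClass {G : Type*} [Group G] {n : ℕ}
    (hcard : Nat.card G = 2 ^ (n + 1)) (hclass : Group.nilpotencyClass G = n) (hn : 2 ≤ n) :
    Nat.card (G ⧸ center G) = 2 ^ n ∧ Nat.card (center G) = 2 := by
  obtain ⟨m, hm, hq, hle⟩ := exists_card_quotient_center_eq hcard (hclass ▸ hn)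
  obtain rfl : m = n := by omega
  refine ⟨hq, ?_⟩
  have hmul := card_eq_card_quotient_mul_card_subgroup (center G)
  rw [hcard, hq, pow_succ] at hmul
  exact (Nat.eq_of_mul_eq_mul_left (by positivity) hmul).symm

theorem mem_center_of_commute_of_index_two {G : Type*} [Group G] {A : Subgroup G}
    (hA : A.index = 2) {x g : G} (hx : x ∉ A) (hgx : Commute g x)
    (hgA : ∀ a ∈ A, Commute g a) : g ∈ Subgroup.center G := by
  rw [Subgroup.mem_center_iff]
  intro y
  by_cases hy : y ∈ A
  · exact (hgA y hy).symm
  · have h : x⁻¹ * y ∈ A := by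
      rw [Subgroup.mul_mem_iff_of_index_two hA, inv_mem_iff]
      simp [hx, hy]
    have := hgx.mul_right (hgA _ h)
    rw [mul_inv_cancel_left] at this
    exact this.symm

open Subgroup in
/-- The inductive step for the existence of a cyclic maximal subgroup: such a subgroup lifts
from the quotient by a center of order two. -/
theorem exists_orderOf_eq_of_quotient_center {G : Type*} [Group G] {n : ℕ}
    (hcard : Nat.card G = 2 ^ (n + 3)) (hZ : Nat.card (center G) = 2)
    (hg : ∃ q : G ⧸ center G, orderOf q = 2 ^ (n + 2 - 1)) (hn : 1 ≤ n) :
    ∃ g : G, orderOf g = 2 ^ (n + 2) := by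
  have : Fact (Nat.Prime 2) := ⟨Nat.prime_two⟩
  obtain ⟨q, hq⟩ := hg
  obtain ⟨g, rfl⟩ := QuotientGroup.mk_surjective q
  rw [show n + 2 - 1 = n + 1 by omega] at hq
  have hsq : ∀ z ∈ center G, z ^ 2 = 1 := fun z hz => by
    have := pow_card_eq_one' (x := (⟨z, hz⟩ : center G))
    rw [hZ] at this
    exact congrArg Subtype.val this
  have hpowZ : ∀ i : ℕ, g ^ i ∈ center G ↔ 2 ^ (n + 1) ∣ i := fun i => by
    rw [← hq, orderOf_dvd_iff_pow_eq_one, ← QuotientGroup.mk_pow, QuotientGroup.eq_one_iff]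
  refine ⟨g, orderOf_eq_prime_pow (p := 2) ?_ ?_⟩
  swap
  · rw [pow_succ, pow_mul]
    exact hsq _ ((hpowZ _).2 dvd_rfl)
  -- Otherwise some `x` inverts `g` modulo the center, and `g ^ 2 ^ n` turns out to be central,
  -- against the order of `g` in the quotient.
  intro hone
  set B : Subgroup G := (zpowers (g : G ⧸ center G)).comap (QuotientGroup.mk' (center G)) with hB
  have hindex : B.index = 2 := by
    rw [hB, index_comap_of_surjective _ (QuotientGroup.mk'_surjective _)]
    have h1 := (zpowers (g : G ⧸ center G)).card_mul_index
    have h2 := card_eq_card_quotient_mul_card_subgroup (center G)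
    rw [Nat.card_zpowers, hq] at h1
    rw [hcard, hZ, ← h1, show 2 ^ (n + 3) = 2 ^ (n + 1) * 2 * 2 by ring] at h2
    exact (Nat.eq_of_mul_eq_mul_left (by positivity) (Nat.eq_of_mul_eq_mul_right two_pos h2)).symm
  have hgB : g ∈ B := mem_zpowers _
  have hform : ∀ b ∈ B, ∃ i : ℤ, ∃ z ∈ center G, b = g ^ i * z := by
    rintro b ⟨i, hi⟩
    refine ⟨i, (g ^ i)⁻¹ * b, ?_, (mul_inv_cancel_left _ _).symm⟩
    rw [← QuotientGroup.eq, QuotientGroup.mk_zpow]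
    exact hi
  have hcomm : ∀ a ∈ B, ∀ b ∈ B, Commute a b := by
    intro a ha b hb
    obtain ⟨i, z, hz, rfl⟩ := hform a ha
    obtain ⟨j, w, hw, rfl⟩ := hform b hb
    have hz' : ∀ y, Commute z y := fun y => (mem_center_iff.1 hz y).symm
    have hw' : ∀ y, Commute y w := mem_center_iff.1 hw
    exact Commute.mul_left ((Commute.zpow_zpow_self g i j).mul_right (hw' _)) (hz' _)
  obtain ⟨x, hx⟩ : ∃ x, x ∉ B := by
    by_contra! h
    rw [← eq_top_iff' B, ← index_eq_one] at h
    omega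
  have hnormal : B.Normal := normal_of_index_eq_two hindex
  have hgx : x * g * x⁻¹ ∈ B := hnormal.conj_mem g hgB x
  -- Conjugation by `x` swaps the two commuting factors, since `x * x ∈ B` commutes with `g`.
  have hw : g * (x * g * x⁻¹) ∈ center G := by
    refine mem_center_of_commute_of_index_two hindex hx ?_ (hcomm _ (mul_mem hgB hgx))
    have h1 : x * x * g = g * (x * x) := hcomm _ (mul_self_mem_of_index_two hindex x) g hgB
    have h2 : g * (x * g * x⁻¹) = x * g * x⁻¹ * g := hcomm g hgB _ hgx
    change g * (x * g * x⁻¹) * x = x * (g * (x * g * x⁻¹))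
    calc g * (x * g * x⁻¹) * x = (x * g * x⁻¹ * g) * x := by rw [h2]
      _ = x * g * x⁻¹ * (g * (x * x)) * x⁻¹ := by group
      _ = x * (g * (x * g * x⁻¹)) := by rw [← h1]; group
  -- As `1 ≤ n`, the exponent is even, and central squares are trivial.
  have hpow : g ^ 2 ^ n * (x * g ^ 2 ^ n * x⁻¹) = 1 := by
    rw [← conj_pow, ← (hcomm g hgB _ hgx).mul_pow,
      show 2 ^ n = 2 * 2 ^ (n - 1) by rw [← pow_succ']; congr; omega, pow_mul, hsq _ hw, one_pow]
  have hsq1 : g ^ 2 ^ n * g ^ 2 ^ n = 1 := by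
    rw [← pow_add, ← two_mul, ← pow_succ', hone]
  have hcx : x * g ^ 2 ^ n * x⁻¹ = g ^ 2 ^ n := mul_left_cancel (hpow.trans hsq1.symm)
  have hmem : g ^ 2 ^ n ∈ center G :=
    mem_center_of_commute_of_index_two hindex hx (mul_inv_eq_iff_eq_mul.1 hcx).symm
      (hcomm _ (pow_mem hgB _))
  rw [hpowZ, Nat.pow_dvd_pow_iff_le_right (le_refl 2)] at hmem
  omega

open Subgroup in
/-- A `2`-group of maximal class and order at least eight has a cyclic maximal subgroup. -/
theorem exists_orderOf_eq_of_nilpotencyClass {n : ℕ} : ∀ {G : Type*} [Group G],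
    Nat.card G = 2 ^ (n + 3) → Group.nilpotencyClass G = n + 2 →
    ∃ g : G, orderOf g = 2 ^ (n + 2) := by
  have : Fact (Nat.Prime 2) := ⟨Nat.prime_two⟩
  induction n with
  | zero =>
    intro G _ hcard hclass
    have hfin : Finite G := Nat.finite_of_card_ne_zero (by rw [hcard]; positivity)
    have hp : IsPGroup 2 G := IsPGroup.of_card hcard
    have : Group.IsNilpotent G := hp.isNilpotent
    have hncomm : ¬ ∀ a b : G, a * b = b * a := by
      intro h
      have : Group.nilpotencyClass G ≤ 1 := by
        rw [Group.IsNilpotent.nilpotencyClass_le_one_iff]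
        exact ⟨⟨h⟩⟩
      omega
    have hex : ∃ g : G, ¬ g ^ 2 = 1 := by
      by_contra! h
      refine hncomm fun a b => ?_
      have h1 : ∀ a : G, a⁻¹ = a := fun a => inv_eq_of_mul_eq_one_left (by rw [← sq, h])
      rw [← h1 (a * b), mul_inv_rev, h1, h1]
    obtain ⟨g, hg⟩ := hex
    refine ⟨g, orderOf_eq_prime_pow (p := 2) (n := 1) (by simpa using hg) ?_⟩
    by_contra h4
    have h8 : orderOf g = 2 ^ (2 + 1) := orderOf_eq_prime_pow (by simpa using h4) (by
      rw [show 2 ^ (2 + 1) = Nat.card G by rw [hcard], pow_card_eq_one'])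
    have : IsCyclic G := isCyclic_of_orderOf_eq_card g (by rw [h8, hcard])
    exact hncomm IsCyclic.commGroup.mul_comm
  | succ n ih =>
    intro G _ hcard hclass
    have hfin : Finite G := Nat.finite_of_card_ne_zero (by rw [hcard]; positivity)
    have : Group.IsNilpotent G := (IsPGroup.of_card hcard).isNilpotent
    obtain ⟨hq, hZ⟩ := card_quotient_center_of_nilpotencyClass hcard hclass (by omega)
    refine exists_orderOf_eq_of_quotient_center hcard hZ (ih hq ?_) (by omega)
    rw [Group.nilpotencyClass_quotient_center, hclass]
    omega

/-! ### Commuting elements and an abelian subgroup of index two -/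

/-- An abelian subgroup of index two in a group whose center has order two. -/
structure IsAbelianIndexTwo {G : Type*} [Group G] (A : Subgroup G) : Prop where
  index : A.index = 2
  commute : ∀ a ∈ A, ∀ b ∈ A, Commute a b
  card_center : Nat.card (Subgroup.center G) = 2
  two_lt_card : 2 < Nat.card A

namespace IsAbelianIndexTwo

variable {G : Type*} [Group G] {A : Subgroup G}

theorem center_le (h : IsAbelianIndexTwo A) : Subgroup.center G ≤ A := by
  intro z hz
  by_contra hzA
  have htop : Subgroup.center G = ⊤ := by
    have hA : A ≤ Subgroup.center G := fun a ha =>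
      mem_center_of_commute_of_index_two h.index hzA
        (Subgroup.mem_center_iff.1 hz a) (h.commute a ha)
    rw [eq_top_iff]
    intro y _
    by_cases hy : y ∈ A
    · exact hA hy
    · have h1 : z⁻¹ * y ∈ A := by
        rw [Subgroup.mul_mem_iff_of_index_two h.index, inv_mem_iff]
        simp [hzA, hy]
      simpa using mul_mem hz (hA h1)
  have h2 := h.card_center
  have h3 := A.card_mul_index
  rw [htop, Subgroup.card_top] at h2
  have := h.two_lt_card
  rw [h2, h.index] at h3
  omega

/-- If `k ∈ A`, its centralizer lies in `A`. If not, the centralizer meets `A` in the center, so any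
two of its elements outside `A` differ by a central factor. -/
theorem centralizer_commute (h : IsAbelianIndexTwo A) {k u v : G} (hk : k ∉ Subgroup.center G)
    (hu : Commute u k) (hv : Commute v k) : Commute u v := by
  by_cases hkA : k ∈ A
  · have key : ∀ w, Commute w k → w ∈ A := by
      intro w hw
      by_contra hwA
      exact hk (mem_center_of_commute_of_index_two h.index hwA hw.symm (h.commute k hkA))
    exact h.commute u (key u hu) v (key v hv)
  · have key : ∀ w ∈ A, Commute w k → ∀ y, Commute w y := fun w hwA hw y =>
      (Subgroup.mem_center_iff.1
        (mem_center_of_commute_of_index_two h.index hkA hw (h.commute w hwA)) y).symm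
    by_cases huA : u ∈ A
    · exact key u huA hu v
    by_cases hvA : v ∈ A
    · exact (key v hvA hv u).symm
    have h1 : u⁻¹ * v ∈ A := by
      rw [Subgroup.mul_mem_iff_of_index_two h.index, inv_mem_iff]
      simp [huA, hvA]
    have := (Commute.refl u).mul_right (key _ h1 (hu.inv_left.mul_left hv) u).symm
    rwa [mul_inv_cancel_left] at this

end IsAbelianIndexTwo

/-! ### Shape and size of the centralizer lattice -/

namespace CentralizerLattice

variable {G : Type*} [Group G]

theorem mem_ofSet_singleton {k g : G} : g ∈ (ofSet {k}).toSubgroup ↔ Commute g k := by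
  simp only [toSubgroup, ofSet, Subgroup.mem_centralizer_iff, Set.mem_singleton_iff, forall_eq]
  exact ⟨Eq.symm, Eq.symm⟩

theorem mem_cent {K : CentralizerLattice G} {g : G} :
    g ∈ K.cent.toSubgroup ↔ ∀ k ∈ K.toSubgroup, Commute g k := by
  simp only [toSubgroup_cent, Subgroup.mem_centralizer_iff, SetLike.mem_coe]
  exact ⟨fun h k hk => (h k hk).symm, fun h k hk => (h k hk).symm⟩

theorem toSubgroup_bot : (⊥ : CentralizerLattice G).toSubgroup = Subgroup.center G :=
  Subgroup.centralizer_univ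

theorem toSubgroup_top : (⊤ : CentralizerLattice G).toSubgroup = ⊤ :=
  eq_top_iff.2 fun _ _ _ hx => hx.elim

theorem cent_top : (⊤ : CentralizerLattice G).cent = ⊥ := by
  apply ext
  rw [toSubgroup_cent, toSubgroup_top, toSubgroup_bot, Subgroup.coe_top,
    Subgroup.centralizer_univ]

theorem cent_bot : (⊥ : CentralizerLattice G).cent = ⊤ := by
  rw [← cent_top, cent_cent]

theorem exists_mem_not_mem_center {K : CentralizerLattice G} (hK : K ≠ ⊥) :
    ∃ k ∈ K.toSubgroup, k ∉ Subgroup.center G := by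
  by_contra! h
  refine hK (le_bot_iff.1 ?_)
  rw [le_def, toSubgroup_bot]
  exact h

variable {A : Subgroup G}

theorem cent_eq_self (h : IsAbelianIndexTwo A) {K : CentralizerLattice G} (hb : K ≠ ⊥)
    (ht : K ≠ ⊤) : K.cent = K := by
  -- `L` lies in the centralizer of a noncentral element, hence is abelian; this is applied to `K`
  -- and to `K.cent`.
  have key : ∀ L : CentralizerLattice G, L.cent ≠ ⊥ → L ≤ L.cent := by
    intro L hL
    obtain ⟨l, hl, hlZ⟩ := exists_mem_not_mem_center hL
    intro u hu
    refine mem_cent.2 fun v hv => ?_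
    exact h.centralizer_commute hlZ (mem_cent.1 hl u hu).symm (mem_cent.1 hl v hv).symm
  apply le_antisymm
  · have := key K.cent (by rwa [cent_cent])
    rwa [cent_cent] at this
  · refine key K fun hc => ht ?_
    rw [← cent_cent K, hc, cent_bot]

theorem eq_ofSet_singleton (h : IsAbelianIndexTwo A) {K : CentralizerLattice G} (hb : K ≠ ⊥)
    (ht : K ≠ ⊤) {k : G} (hk : k ∈ K.toSubgroup) (hkZ : k ∉ Subgroup.center G) :
    K = ofSet {k} := by
  have hc := cent_eq_self h hb ht
  apply le_antisymm
  · intro g hg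
    rw [← hc] at hg
    exact mem_ofSet_singleton.2 (mem_cent.1 hg k hk)
  · intro g hg
    rw [← hc]
    refine mem_cent.2 fun y hy => ?_
    rw [← hc] at hy
    exact h.centralizer_commute hkZ (mem_ofSet_singleton.1 hg) (mem_cent.1 hy k hk)

/-- The involution reverses order but fixes every element other than `⊥` and `⊤`. -/
theorem le_iff (h : IsAbelianIndexTwo A) {K L : CentralizerLattice G} :
    K ≤ L ↔ K = ⊥ ∨ L = ⊤ ∨ K = L := by
  constructor
  · intro hKL
    by_contra! hne
    obtain ⟨hb, ht, hne⟩ := hne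
    refine hne (le_antisymm hKL ?_)
    have h1 := cent_anti hKL
    rwa [cent_eq_self h hb (ne_top_of_le_ne_top ht hKL),
      cent_eq_self h (ne_bot_of_le_ne_bot hb hKL) ht] at h1
  · rintro (rfl | rfl | rfl) <;> simp

theorem toSubgroup_ofSet_singleton_of_mem (h : IsAbelianIndexTwo A) {a : G} (ha : a ∈ A)
    (haZ : a ∉ Subgroup.center G) : (ofSet {a}).toSubgroup = A := by
  ext g
  rw [mem_ofSet_singleton]
  refine ⟨fun hg => ?_, fun hg => h.commute g hg a ha⟩
  by_contra hgA
  exact haZ (mem_center_of_commute_of_index_two h.index hgA hg.symm (h.commute a ha))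

theorem ofSet_singleton_eq_iff (h : IsAbelianIndexTwo A) {x y : G} (hx : x ∉ A) (hy : y ∉ A) :
    ofSet {y} = ofSet {x} ↔ x⁻¹ * y ∈ Subgroup.center G := by
  constructor
  · intro hxy
    have hc : Commute y x := by
      rw [← mem_ofSet_singleton, ← hxy, mem_ofSet_singleton]
    have h1 : x⁻¹ * y ∈ A := by
      rw [Subgroup.mul_mem_iff_of_index_two h.index, inv_mem_iff]
      simp [hx, hy]
    exact mem_center_of_commute_of_index_two h.index hx
      ((Commute.refl x).inv_left.mul_left hc) (h.commute _ h1)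
  · intro hz
    have hz' : ∀ g, Commute g (x⁻¹ * y) := Subgroup.mem_center_iff.1 hz
    apply ext
    ext g
    rw [mem_ofSet_singleton, mem_ofSet_singleton]
    constructor
    · intro hg
      have := hg.mul_right (hz' g).inv_right
      simpa using this
    · intro hg
      have := hg.mul_right (hz' g)
      simpa using this

open Finset in
theorem card_eq (h : IsAbelianIndexTwo A) :
    2 * Nat.card (CentralizerLattice G) = Nat.card A + 6 := by
  classical
  have hfinA : Finite A := Nat.finite_of_card_ne_zero (by have := h.two_lt_card; omega)
  have hcardG : Nat.card A * 2 = Nat.card G := by rw [← h.index]; exact A.card_mul_index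
  have hfin : Finite G :=
    Nat.finite_of_card_ne_zero (by have := h.two_lt_card; omega)
  have : Fintype G := Fintype.ofFinite G
  have : Finite (CentralizerLattice G) := Subtype.finite
  have : Fintype (CentralizerLattice G) := Fintype.ofFinite _
  obtain ⟨a, haA, haZ⟩ : ∃ a ∈ A, a ∉ Subgroup.center G := by
    by_contra! hle
    have := Subgroup.card_le_of_le (show A ≤ Subgroup.center G from hle)
    rw [h.card_center] at this
    exact absurd h.two_lt_card (by omega)
  set S : Finset G := univ.filter (· ∉ A) with hS
  set c : G → CentralizerLattice G := fun x => ofSet {x} with hc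
  have hself : ∀ x, x ∈ (c x).toSubgroup := fun x => mem_ofSet_singleton.2 (Commute.refl x)
  have hfilter : (univ.filter (· ∈ A)).card = Nat.card A := by
    rw [Nat.card_eq_fintype_card, Fintype.card_subtype]
  have hScard : S.card = Nat.card A := by
    have := card_filter_add_card_filter_not (s := (univ : Finset G)) (· ∈ A)
    rw [card_univ, ← Nat.card_eq_fintype_card, ← hcardG, hfilter] at this
    rw [hS]
    omega
  -- The fibres of `x ↦ C_G(x)` outside `A` are cosets of the center.
  have hfib : ∀ K ∈ S.image c, (S.filter (c · = K)).card = 2 := by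
    intro K hK
    obtain ⟨x, hx, rfl⟩ := mem_image.1 hK
    have hxA : x ∉ A := (mem_filter.1 hx).2
    rw [← h.card_center, Nat.card_eq_fintype_card, ← card_univ,
      ← card_map (⟨fun z : Subgroup.center G => x * z, fun z w hzw => by simpa using hzw⟩ :
        Subgroup.center G ↪ G)]
    congr 1
    ext y
    simp only [mem_filter, mem_map, mem_univ, true_and, hS]
    constructor
    · rintro ⟨hy, hyx⟩
      exact ⟨⟨x⁻¹ * y, (ofSet_singleton_eq_iff h hxA hy).1 hyx⟩, mul_inv_cancel_left x y⟩
    · rintro ⟨z, rfl⟩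
      have hxz : x * (z : G) ∉ A := by
        rw [mul_mem_cancel_right (h.center_le z.2)]
        exact hxA
      refine ⟨hxz, (ofSet_singleton_eq_iff h hxA hxz).2 ?_⟩
      simp
  have hI := card_eq_sum_card_image c S
  rw [sum_congr rfl hfib, sum_const, smul_eq_mul, hScard] at hI
  have hmemI : ∀ K ∈ S.image c, ∃ x, x ∉ A ∧ c x = K := by
    intro K hK
    obtain ⟨x, hx, rfl⟩ := mem_image.1 hK
    exact ⟨x, (mem_filter.1 hx).2, rfl⟩
  have htopb : (⊤ : CentralizerLattice G) ≠ ⊥ := by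
    intro he
    have := congrArg toSubgroup he
    rw [toSubgroup_top, toSubgroup_bot] at this
    exact haZ (this ▸ Subgroup.mem_top a)
  have hAI : c a ∉ S.image c := by
    intro hK
    obtain ⟨x, hx, hxa⟩ := hmemI _ hK
    apply hx
    rw [← toSubgroup_ofSet_singleton_of_mem h haA haZ]
    change x ∈ (c a).toSubgroup
    rw [← hxa]
    exact hself x
  have hcb : ∀ x, x ∉ Subgroup.center G → c x ≠ ⊥ := by
    intro x hx he
    apply hx
    rw [← toSubgroup_bot, ← he]
    exact hself x
  have hct : ∀ x, x ∉ Subgroup.center G → c x ≠ ⊤ := by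
    intro x hx he
    refine hx (Subgroup.mem_center_iff.2 fun g => ?_)
    have : g ∈ (c x).toSubgroup := by rw [he, toSubgroup_top]; trivial
    exact mem_ofSet_singleton.1 this
  have huniv : (univ : Finset (CentralizerLattice G)) =
      insert ⊤ (insert ⊥ (insert (c a) (S.image c))) := by
    symm
    rw [eq_univ_iff_forall]
    intro K
    by_cases ht : K = ⊤
    · simp [ht]
    by_cases hb : K = ⊥
    · simp [hb]
    obtain ⟨k, hk, hkZ⟩ := exists_mem_not_mem_center hb
    have hKk := eq_ofSet_singleton h hb ht hk hkZ
    by_cases hkA : k ∈ A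
    · have : K = c a := by
        apply ext
        rw [hKk, toSubgroup_ofSet_singleton_of_mem h hkA hkZ,
          toSubgroup_ofSet_singleton_of_mem h haA haZ]
      simp [this]
    · have : K ∈ S.image c := mem_image.2 ⟨k, by simp [hS, hkA], hKk.symm⟩
      simp only [mem_insert, this, or_true]
  rw [Nat.card_eq_fintype_card, ← card_univ, huniv, card_insert_of_notMem, card_insert_of_notMem,
    card_insert_of_notMem hAI]
  · omega
  · rw [mem_insert, not_or]
    refine ⟨(hcb a haZ).symm, fun hK => ?_⟩
    obtain ⟨x, hx, hxK⟩ := hmemI _ hK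
    exact hcb x (fun hz => hx (h.center_le hz)) hxK
  · rw [mem_insert, mem_insert, not_or, not_or]
    refine ⟨htopb, (hct a haZ).symm, fun hK => ?_⟩
    obtain ⟨x, hx, hxK⟩ := hmemI _ hK
    exact hct x (fun hz => hx (h.center_le hz)) hxK

end CentralizerLattice

theorem exists_isAbelianIndexTwo {G : Type*} [Group G] {n : ℕ} (hn : 2 < n)
    (hG : IsPGroupOfMaximalClass 2 G) (hcard : Nat.card G = 2 ^ n) :
    ∃ A : Subgroup G, IsAbelianIndexTwo A ∧ Nat.card A = 2 ^ (n - 1) := by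
  obtain ⟨m, -, hm, hclass⟩ := hG
  obtain rfl : n = m := Nat.pow_right_injective (le_refl 2) (hcard.symm.trans hm)
  obtain ⟨k, rfl⟩ : ∃ k, n = k + 3 := ⟨n - 3, by omega⟩
  obtain ⟨g, hg⟩ := exists_orderOf_eq_of_nilpotencyClass (n := k) hcard (by omega)
  have hA : Nat.card (Subgroup.zpowers g) = 2 ^ (k + 2) := by rw [Nat.card_zpowers, hg]
  refine ⟨Subgroup.zpowers g, ⟨?_, ?_, ?_, ?_⟩, hA⟩
  · have := (Subgroup.zpowers g).card_mul_index
    rw [hA, hcard, pow_succ 2 (k + 2)] at this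
    exact Nat.eq_of_mul_eq_mul_left (by positivity) this
  · rintro _ ⟨i, rfl⟩ _ ⟨j, rfl⟩
    exact Commute.zpow_zpow_self g i j
  · exact (card_quotient_center_of_nilpotencyClass (n := k + 2) hcard (by omega) (by omega)).2
  · rw [hA, pow_add]
    have := Nat.one_le_two_pow (n := k)
    omega

/-! ### Construction of the isomorphism -/

namespace CentralizerLattice

variable {G H : Type*} [Group G] [Group H] {A : Subgroup G} {B : Subgroup H}

theorem exists_equiv_top_bot (hA : IsAbelianIndexTwo A) (hB : IsAbelianIndexTwo B)
    (hcard : Nat.card A = Nat.card B) :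
    ∃ e : CentralizerLattice G ≃ CentralizerLattice H, e ⊤ = ⊤ ∧ e ⊥ = ⊥ := by
  classical
  have hG := card_eq hA
  have hH := card_eq hB
  have hGfin : Finite (CentralizerLattice G) := Nat.finite_of_card_ne_zero (by omega)
  have hHfin : Finite (CentralizerLattice H) := Nat.finite_of_card_ne_zero (by omega)
  obtain ⟨e⟩ := Finite.card_eq.1 (show Nat.card (CentralizerLattice G) =
    Nat.card (CentralizerLattice H) by omega)
  have : Nontrivial (CentralizerLattice G) := Finite.one_lt_card_iff_nontrivial.1 (by omega)
  have : Nontrivial (CentralizerLattice H) := Finite.one_lt_card_iff_nontrivial.1 (by omega)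
  set e₁ := e.trans (Equiv.swap (e ⊤) ⊤) with he₁
  have h1 : e₁ ⊤ = ⊤ := by simp [he₁]
  -- The second swap leaves `⊤` in place, because neither `e₁ ⊥` nor `⊥` equals `⊤`.
  refine ⟨e₁.trans (Equiv.swap (e₁ ⊥) ⊥), ?_, by simp⟩
  rw [Equiv.trans_apply, h1]
  refine Equiv.swap_apply_of_ne_of_ne ?_ top_ne_bot
  intro h2
  exact top_ne_bot (e₁.injective (h1.trans h2))

/-- By `le_iff` and `cent_eq_self`, the order and the involution are determined by `⊥`, `⊤` and
equality alone. -/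
theorem nonempty_iso (hA : IsAbelianIndexTwo A) (hB : IsAbelianIndexTwo B)
    (hcard : Nat.card A = Nat.card B) : Nonempty (CentralizerLatticeIso G H) := by
  obtain ⟨e, ht, hb⟩ := exists_equiv_top_bot hA hB hcard
  have hle : ∀ K L, e K ≤ e L ↔ K ≤ L := by
    intro K L
    rw [le_iff hA, le_iff hB, ← ht, ← hb]
    simp only [e.injective.eq_iff]
  let f : CentralizerLattice G ≃o CentralizerLattice H := ⟨e, hle _ _⟩
  have hcent : ∀ K, f K.cent = (f K).cent := by
    intro K
    change e K.cent = (e K).cent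
    by_cases h1 : K = ⊤
    · rw [h1, cent_top, ht, hb, cent_top]
    by_cases h2 : K = ⊥
    · rw [h2, cent_bot, ht, hb, cent_bot]
    rw [cent_eq_self hA h2 h1, cent_eq_self hB]
    · rwa [← hb, e.injective.ne_iff]
    · rwa [← ht, e.injective.ne_iff]
  exact ⟨{
    hom := { toFun := f, map_sup' := f.map_sup, map_inf' := f.map_inf, map_cent' := hcent }
    inv := {
      toFun := f.symm
      map_sup' := f.symm.map_sup
      map_inf' := f.symm.map_inf
      map_cent' := fun K => by
        apply f.injective
        rw [hcent, f.apply_symm_apply, f.apply_symm_apply] }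
    left_inv := f.symm_apply_apply
    right_inv := f.apply_symm_apply }⟩

end CentralizerLattice

theorem mainTheorem4 {G H : Type*} [Group G] [Group H] (n : ℕ) (hn : 2 < n)
    (hG : IsPGroupOfMaximalClass 2 G) (hGcard : Nat.card G = 2 ^ n)
    (hH : IsPGroupOfMaximalClass 2 H) (hHcard : Nat.card H = 2 ^ n) :
    Nonempty (CentralizerLatticeIso G H) := by
  obtain ⟨A, hA, hAcard⟩ := exists_isAbelianIndexTwo hn hG hGcard
  obtain ⟨B, hB, hBcard⟩ := exists_isAbelianIndexTwo hn hH hHcard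
  exact CentralizerLattice.nonempty_iso hA hB (hAcard.trans hBcard.symm)
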